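/- Let $\Bbbk$ be a field and let $(A,\mathcal H)$ be a left bialgebroid over $\Bbbk$: $A$ and $\mathcal H$ are $\Bbbk$-algebras, $\eta\colon A\otimes_\Bbbk A^{\mathrm o}\to\mathcal H$ is a $\Bbbk$-algebra map with source $s(a)=\eta(a\otimes 1)$ and target $t(a^{\mathrm o})=\eta(1\otimes a^{\mathrm o})$, and $(\mathcal H,\Delta,\varepsilon)$ is an $A$-coring for the $A$-bimodule structure $a\cdot x\cdot b=s(a)t(b^{\mathrm o})x$, such that $\Delta$ is a $\Bbbk$-algebra map into the Takeuchi product $\mathcal H\times_A\mathcal H=\{\sum_i x_i\otimes_A y_i\mid \sum_i x_it(a^{\mathrm o})\otimes_A y_i=\sum_i x_i\otimes_A y_is(a)\ \forall a\in A\}$, $\varepsilon(xs(\varepsilon(y)))=\varepsilon(xy)=\varepsilon(xt(\varepsilon(y)^{\mathrm o}))$ for all $x,y\in\mathcal H$, and $\varepsilon(1)=1$. For left $\mathcal H$-modules $M,N$, $M\otimes_A N$ denotes the quotient of $M\otimes_\Bbbk N$ by the relations $t(a^{\mathrm o})m\otimes n=m\otimes s(a)n$. Assume that $\mathcal H$ is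 flat as a left $A$-module via $s$. A left ideal two-sided coideal is a left ideal $I$ of $\mathcal H$ such that $\Delta(I)$ lies in the canonical image of $I\otimes_A\mathcal H+\mathcal H\otimes_A I$ in $\mathcal H\otimes_A\mathcal H$ and $\varepsilon(I)=0$. A right $\mathcal H$-comodule $A^{\mathrm o}$-subring of $\mathcal H$ via $t$ is a $\Bbbk$-subalgebra $B\subseteq\mathcal H$ containing $t(A^{\mathrm o})$, with inclusion $\iota\colon B\to\mathcal H$ and right $A$-action $b\cdot a=t(a^{\mathrm o})b$, that admits a right $A$-linear, coassociative and counital right $\mathcal H$-coaction $\delta\colon B\to B\otimes_A\mathcal H$ with $(\iota\otimes_A\mathcal H)\circ\delta=\Delta\circ\iota$. For a left ideal two-sided coideal $I$ with projection $\pi\colon\mathcal H\to\mathcal H/I$, put $$\Psi(I)=\mathcal H^{\mathrm{co}\,\mathcal H/I}=\Big\{x\in\mathcal H\ \Big|\ \sum\pi(x_1)\otimes_A x_2=\pi(1)\otimes_A x \text{ in } \mathcal H/I\otimes_A\mathcal H\Big\},$$ and for a right $\mathcal H$-comodule $A^{\mathrm o}$-subring $B$ put $\Phi(B)=\mathcal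 HB^+$, the left ideal generated by $B^+=B\cap\ker\varepsilon$. Then the left ideal two-sided coideals of $\mathcal H$ and the right $\mathcal H$-comodule $A^{\mathrm o}$-subrings of $\mathcal H$ via $t$, each ordered by inclusion, are lattices, $\Psi$ and $\Phi$ are well-defined inclusion-preserving maps between them (that is, $\Psi(I)$ is a right $\mathcal H$-comodule $A^{\mathrm o}$-subring via $t$ and $\Phi(B)$ is a left ideal two-sided coideal), and: 1. $\Psi\Phi\Psi(I)=\Psi(I)$ for every left ideal two-sided coideal $I$; 2. $\Phi\Psi\Phi(B)=\Phi(B)$ for every right $\mathcal H$-comodule $A^{\mathrm o}$-subring $B$ via $t$; 3. $\Phi$ and $\Psi$ form a monotone Galois connection: $\mathcal HB^+\subseteq I$ if and only if $B\subseteq\mathcal H^{\mathrm{co}\,\mathcal H/I}$, for all such $B$ and $I$. -/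

import Mathlib

open scoped TensorProduct

universe uk uA uH uM uN uP uM' uN'

namespace Bialgebroid

/-! ### Tensor products over a possibly non-commutative algebra -/

section TensorOverA

variable (k : Type uk) [Field k] (A : Type uA) [Ring A] [Algebra k A]

/-- A left `A`-module structure on the `k`-vector space `N`. -/
abbrev LeftAct (N : Type uN) [AddCommGroup N] [Module k N] := A →ₐ[k] Module.End k N

/-- A right `A`-module structure on the `k`-vector space `M`. -/
abbrev RightAct (M : Type uM) [AddCommGroup M] [Module k M] := Aᵐᵒᵖ →ₐ[k] Module.End k M

variable {k A}
variable {M : Type uM} [AddCommGroup M] [Module k M] {N : Type uN} [AddCommGroup N] [Module k N]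
  {P : Type uP} [AddCommGroup P] [Module k P]
  {M' : Type uM'} [AddCommGroup M'] [Module k M'] {N' : Type uN'} [AddCommGroup N'] [Module k N']

/-- The span of all `m · a ⊗ n - m ⊗ a · n` in `M ⊗ N`. -/
def tensorRel (r : RightAct k A M) (l : LeftAct k A N) : Submodule k (M ⊗[k] N) :=
  Submodule.span k {z | ∃ (m : M) (a : A) (n : N),
    z = r (MulOpposite.op a) m ⊗ₜ[k] n - m ⊗ₜ[k] l a n}

/-- The tensor product `M ⊗_A N` of a right and a left `A`-module. -/
abbrev BTensor (r : RightAct k A M) (l : LeftAct k A N) := (M ⊗[k] N) ⧸ tensorRel r l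

namespace BTensor

/-- The pure tensor `m ⊗_A n`. -/
def tmul (r : RightAct k A M) (l : LeftAct k A N) (m : M) (n : N) : BTensor r l :=
  (tensorRel r l).mkQ (m ⊗ₜ[k] n)

theorem tmul_act (r : RightAct k A M) (l : LeftAct k A N) (m : M) (a : A) (n : N) :
    tmul r l (r (MulOpposite.op a) m) n = tmul r l m (l a n) := by
  unfold tmul
  rw [← sub_eq_zero, ← map_sub, Submodule.mkQ_apply, Submodule.Quotient.mk_eq_zero]
  exact Submodule.subset_span ⟨m, a, n, rfl⟩

/-- Linear maps out of `M ⊗_A N` agree if they agree on pure tensors. -/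
theorem hom_ext {r : RightAct k A M} {l : LeftAct k A N} {f g : BTensor r l →ₗ[k] P}
    (h : ∀ m n, f (tmul r l m n) = g (tmul r l m n)) : f = g := by
  apply Submodule.linearMap_qext
  apply TensorProduct.ext'
  exact h

/-- The linear map on `M ⊗_A N` induced by an `A`-balanced bilinear map. -/
def lift (r : RightAct k A M) (l : LeftAct k A N) (f : M →ₗ[k] N →ₗ[k] P)
    (hf : ∀ (m : M) (a : A) (n : N), f (r (MulOpposite.op a) m) n = f m (l a n)) :
    BTensor r l →ₗ[k] P :=
  (tensorRel r l).liftQ (TensorProduct.lift f) <| by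
    rw [tensorRel, Submodule.span_le]
    rintro _ ⟨m, a, n, rfl⟩
    simp [hf]

@[simp] theorem lift_tmul (r : RightAct k A M) (l : LeftAct k A N) (f : M →ₗ[k] N →ₗ[k] P)
    (hf : ∀ (m : M) (a : A) (n : N), f (r (MulOpposite.op a) m) n = f m (l a n)) (m : M) (n : N) :
    lift r l f hf (tmul r l m n) = f m n := by
  simp [lift, tmul]

/-- The map `f ⊗_A g` for `f` right `A`-linear and `g` left `A`-linear. -/
def map {r : RightAct k A M} {l : LeftAct k A N} {r' : RightAct k A M'} {l' : LeftAct k A N'}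
    (f : M →ₗ[k] M') (g : N →ₗ[k] N') (hf : ∀ a m, f (r a m) = r' a (f m))
    (hg : ∀ a n, g (l a n) = l' a (g n)) : BTensor r l →ₗ[k] BTensor r' l' :=
  (tensorRel r l).mapQ (tensorRel r' l') (TensorProduct.map f g) <| by
    rw [tensorRel, Submodule.span_le]
    rintro _ ⟨m, a, n, rfl⟩
    refine Submodule.subset_span ⟨f m, a, g n, ?_⟩
    simp [hf, hg]

@[simp] theorem map_tmul {r : RightAct k A M} {l : LeftAct k A N} {r' : RightAct k A M'}
    {l' : LeftAct k A N'} (f : M →ₗ[k] M') (g : N →ₗ[k] N') (hf : ∀ a m, f (r a m) = r' a (f m))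
    (hg : ∀ a n, g (l a n) = l' a (g n)) (m : M) (n : N) :
    map f g hf hg (tmul r l m n) = tmul r' l' (f m) (g n) := by
  simp [map, tmul]

theorem tmul_add_left (r : RightAct k A M) (l : LeftAct k A N) (m m' : M) (n : N) :
    tmul r l (m + m') n = tmul r l m n + tmul r l m' n := by
  simp [tmul, TensorProduct.add_tmul]

theorem tmul_smul_left (r : RightAct k A M) (l : LeftAct k A N) (c : k) (m : M) (n : N) :
    tmul r l (c • m) n = c • tmul r l m n := by
  simp only [tmul, ← TensorProduct.smul_tmul', map_smul]

theorem tmul_add_right (r : RightAct k A M) (l : LeftAct k A N) (m : M) (n n' : N) :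
    tmul r l m (n + n') = tmul r l m n + tmul r l m n' := by
  simp [tmul, TensorProduct.tmul_add]

theorem tmul_smul_right (r : RightAct k A M) (l : LeftAct k A N) (c : k) (m : M) (n : N) :
    tmul r l m (c • n) = c • tmul r l m n := by
  simp [tmul]

theorem zero_tmul (r : RightAct k A M) (l : LeftAct k A N) (n : N) : tmul r l 0 n = 0 := by
  simp only [tmul, TensorProduct.zero_tmul, map_zero]

theorem tmul_zero (r : RightAct k A M) (l : LeftAct k A N) (m : M) : tmul r l m 0 = 0 := by
  simp only [tmul, TensorProduct.tmul_zero, map_zero]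

/-- The pure tensor as a bilinear map. -/
def mk (r : RightAct k A M) (l : LeftAct k A N) : M →ₗ[k] N →ₗ[k] BTensor r l :=
  LinearMap.mk₂ k (tmul r l) (tmul_add_left r l) (tmul_smul_left r l) (tmul_add_right r l)
    (tmul_smul_right r l)

@[simp] theorem mk_apply (r : RightAct k A M) (l : LeftAct k A N) (m : M) (n : N) :
    mk r l m n = tmul r l m n := rfl

/-- If `N` is an `A`-bimodule, then `M ⊗_A N` is a right `A`-module by
`(m ⊗ n) · a = m ⊗ n · a`. -/
def rightAct (r : RightAct k A M) (l : LeftAct k A N) (rN : RightAct k A N)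
    (h : ∀ a b n, rN b (l a n) = l a (rN b n)) : RightAct k A (BTensor r l) where
  toFun b := map LinearMap.id (rN b) (fun _ _ => rfl) (fun a n => h a b n)
  map_one' := hom_ext fun m n => by simp
  map_mul' b c := hom_ext fun m n => by simp
  map_zero' := hom_ext fun m n => by
    rw [map_tmul, map_zero, LinearMap.zero_apply, LinearMap.zero_apply, tmul_zero]
  map_add' b c := hom_ext fun m n => by simp [tmul_add_right]
  commutes' c := hom_ext fun m n => by
    rw [map_tmul, AlgHom.commutes, Module.algebraMap_end_apply, Module.algebraMap_end_apply,
      tmul_smul_right, LinearMap.id_apply]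

/-- If `M` is an `A`-bimodule, then `M ⊗_A N` is a left `A`-module by
`a · (m ⊗ n) = a · m ⊗ n`. -/
def leftAct (r : RightAct k A M) (l : LeftAct k A N) (lM : LeftAct k A M)
    (h : ∀ a b m, r b (lM a m) = lM a (r b m)) : LeftAct k A (BTensor r l) where
  toFun a := map (lM a) LinearMap.id (fun b m => (h a b m).symm) (fun _ _ => rfl)
  map_one' := hom_ext fun m n => by simp
  map_mul' b c := hom_ext fun m n => by simp
  map_zero' := hom_ext fun m n => by
    rw [map_tmul, map_zero, LinearMap.zero_apply, LinearMap.zero_apply, zero_tmul]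
  map_add' b c := hom_ext fun m n => by simp [tmul_add_left]
  commutes' c := hom_ext fun m n => by
    rw [map_tmul, AlgHom.commutes, Module.algebraMap_end_apply, Module.algebraMap_end_apply,
      tmul_smul_left, LinearMap.id_apply]

@[simp] theorem rightAct_tmul (r : RightAct k A M) (l : LeftAct k A N) (rN : RightAct k A N)
    (h : ∀ a b n, rN b (l a n) = l a (rN b n)) (b : Aᵐᵒᵖ) (m : M) (n : N) :
    rightAct r l rN h b (tmul r l m n) = tmul r l m (rN b n) :=
  map_tmul LinearMap.id (rN b) (fun _ _ => rfl) (fun a n => h a b n) m n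

@[simp] theorem leftAct_tmul (r : RightAct k A M) (l : LeftAct k A N) (lM : LeftAct k A M)
    (h : ∀ a b m, r b (lM a m) = lM a (r b m)) (a : A) (m : M) (n : N) :
    leftAct r l lM h a (tmul r l m n) = tmul r l (lM a m) n :=
  map_tmul (lM a) LinearMap.id (fun b m => (h a b m).symm) (fun _ _ => rfl) m n

/-- The map `n ⊗ p ↦ (m ⊗ n) ⊗ p`. -/
def assocAux (r : RightAct k A M) (lN : LeftAct k A N) (rN : RightAct k A N) (l : LeftAct k A P)
    (h : ∀ a b n, rN b (lN a n) = lN a (rN b n)) (m : M) :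
    BTensor rN l →ₗ[k] BTensor (rightAct r lN rN h) l :=
  map (mk r lN m) LinearMap.id (fun b n => (rightAct_tmul r lN rN h b m n).symm) (fun _ _ => rfl)

@[simp] theorem assocAux_tmul (r : RightAct k A M) (lN : LeftAct k A N) (rN : RightAct k A N)
    (l : LeftAct k A P) (h : ∀ a b n, rN b (lN a n) = lN a (rN b n)) (m : M) (n : N) (p : P) :
    assocAux r lN rN l h m (tmul rN l n p) =
      tmul (rightAct r lN rN h) l (tmul r lN m n) p :=
  map_tmul (r' := rightAct r lN rN h) (mk r lN m) LinearMap.id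
    (fun b n => (rightAct_tmul r lN rN h b m n).symm) (fun _ _ => rfl) n p

/-- The associativity constraint `M ⊗_A (N ⊗_A P) → (M ⊗_A N) ⊗_A P`,
`m ⊗ (n ⊗ p) ↦ (m ⊗ n) ⊗ p`, for an `A`-bimodule `N`. -/
def assocInv (r : RightAct k A M) (lN : LeftAct k A N) (rN : RightAct k A N) (l : LeftAct k A P)
    (h : ∀ a b n, rN b (lN a n) = lN a (rN b n)) :
    BTensor r (leftAct rN l lN h) →ₗ[k] BTensor (rightAct r lN rN h) l :=
  lift r (leftAct rN l lN h)
    { toFun := assocAux r lN rN l h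
      map_add' := fun m m' => hom_ext fun n p => by
        rw [LinearMap.add_apply, assocAux_tmul, assocAux_tmul, assocAux_tmul, tmul_add_left,
          tmul_add_left]
      map_smul' := fun c m => hom_ext fun n p => by
        rw [RingHom.id_apply, LinearMap.smul_apply, assocAux_tmul, assocAux_tmul, tmul_smul_left,
          tmul_smul_left] }
    (fun m a x => by
      change assocAux r lN rN l h (r (MulOpposite.op a) m) x =
        (assocAux r lN rN l h m ∘ₗ leftAct rN l lN h a) x
      congr 1
      exact hom_ext fun n p => by
        rw [LinearMap.comp_apply, leftAct_tmul, assocAux_tmul, assocAux_tmul, tmul_act])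

@[simp] theorem assocInv_tmul (r : RightAct k A M) (lN : LeftAct k A N) (rN : RightAct k A N)
    (l : LeftAct k A P) (h : ∀ a b n, rN b (lN a n) = lN a (rN b n)) (m : M) (n : N) (p : P) :
    assocInv r lN rN l h (tmul r (leftAct rN l lN h) m (tmul rN l n p)) =
      tmul (rightAct r lN rN h) l (tmul r lN m n) p := by
  unfold assocInv
  rw [lift_tmul]
  exact assocAux_tmul r lN rN l h m n p

end BTensor

variable (k A)

/-- `A` as a left module over itself. -/
def regLeft : LeftAct k A A := Algebra.lsmul k k A

/-- `A` as a right module over itself. -/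
def regRight : RightAct k A A := Algebra.lsmul k k A

variable {k A}

@[simp] theorem regLeft_apply (a x : A) : regLeft k A a x = a * x := rfl

@[simp] theorem regRight_apply (a : Aᵐᵒᵖ) (x : A) : regRight k A a x = x * a.unop := rfl

/-- The unit constraint `A ⊗_A N → N`, `a ⊗ n ↦ a · n`. -/
def lid (l : LeftAct k A N) : BTensor (regRight k A) l →ₗ[k] N :=
  BTensor.lift _ _ l.toLinearMap (fun m a n => by simp)

@[simp] theorem lid_tmul (l : LeftAct k A N) (a : A) (n : N) :
    lid l (BTensor.tmul _ _ a n) = l a n :=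
  BTensor.lift_tmul _ _ _ _ a n

/-- The unit constraint `M ⊗_A A → M`, `m ⊗ a ↦ m · a`. -/
def rid (r : RightAct k A M) : BTensor r (regLeft k A) →ₗ[k] M :=
  BTensor.lift _ _ (r.toLinearMap ∘ₗ (MulOpposite.opLinearEquiv k).toLinearMap).flip
    (fun m a n => by simp)

@[simp] theorem rid_tmul (r : RightAct k A M) (m : M) (a : A) :
    rid r (BTensor.tmul _ _ m a) = r (MulOpposite.op a) m :=
  BTensor.lift_tmul _ _ _ _ m a

/-- Flatness of a left `A`-module `N`: the functor `- ⊗_A N` preserves injectivity of morphisms of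
right `A`-modules. -/
def IsFlat (l : LeftAct k A N) : Prop :=
  ∀ (M M' : Type (max uA uN)) [AddCommGroup M] [AddCommGroup M'] [Module k M] [Module k M']
    (r : RightAct k A M) (r' : RightAct k A M') (f : M →ₗ[k] M')
    (hf : ∀ a m, f (r a m) = r' a (f m)), Function.Injective f →
    Function.Injective (BTensor.map f LinearMap.id hf (fun _ _ => rfl) :
      BTensor r l →ₗ[k] BTensor r' l)

end TensorOverA

/-! ### Rings over the enveloping algebra -/

section AeRing

variable {k : Type uk} [Field k] {A : Type uA} [Ring A] [Algebra k A]
  {H : Type uH} [Ring H] [Algebra k H] (η : A ⊗[k] Aᵐᵒᵖ →ₐ[k] H)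

/-- The source map `a ↦ η (a ⊗ 1)`. -/
def src : A →ₐ[k] H := η.comp Algebra.TensorProduct.includeLeft

/-- The target map `aᵒ ↦ η (1 ⊗ aᵒ)`. -/
def tgt : Aᵐᵒᵖ →ₐ[k] H := η.comp Algebra.TensorProduct.includeRight

theorem tgt_mul_src (a : A) (b : Aᵐᵒᵖ) : tgt η b * src η a = src η a * tgt η b := by
  simp [src, tgt, ← map_mul]

variable (M : Type uM) [AddCommGroup M] [Module k M] [Module H M] [IsScalarTower k H M]
  (N : Type uN) [AddCommGroup N] [Module k N] [Module H N] [IsScalarTower k H N]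

/-- The left `A`-module structure `a · m = s(a) m` on a left `H`-module. -/
def srcAct : LeftAct k A M := (Algebra.lsmul k k M).comp (src η)

/-- The right `A`-module structure `m · a = t(aᵒ) m` on a left `H`-module. -/
def tgtAct : RightAct k A M := (Algebra.lsmul k k M).comp (tgt η)

variable {M N}

@[simp] theorem srcAct_apply (a : A) (m : M) : srcAct η M a m = src η a • m := rfl

@[simp] theorem tgtAct_apply (a : Aᵐᵒᵖ) (m : M) : tgtAct η M a m = tgt η a • m := rfl

theorem tgtAct_srcAct (a : A) (b : Aᵐᵒᵖ) (m : M) :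
    tgtAct η M b (srcAct η M a m) = srcAct η M a (tgtAct η M b m) := by
  simp [smul_smul, tgt_mul_src]

variable (M N)

/-- `M ⊗_A N` for left `H`-modules: `t(aᵒ) m ⊗ n = m ⊗ s(a) n`. -/
abbrev HTensor := BTensor (tgtAct η M) (srcAct η N)

variable {M N}

/-- The map `x ⊗ y ↦ x u ⊗ y v` on `H ⊗_A H`. -/
def mulRight₂ (u v : H) : HTensor η H H →ₗ[k] HTensor η H H :=
  BTensor.map (LinearMap.mulRight k u) (LinearMap.mulRight k v)
    (fun a m => by simp [mul_assoc]) (fun a n => by simp [mul_assoc])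

@[simp] theorem mulRight₂_tmul (u v x y : H) :
    mulRight₂ η u v (BTensor.tmul _ _ x y) = BTensor.tmul _ _ (x * u) (y * v) :=
  BTensor.map_tmul _ _ _ _ x y

theorem mulRight₂_comp (u v u' v' : H) (z : HTensor η H H) :
    mulRight₂ η u v (mulRight₂ η u' v' z) = mulRight₂ η (u' * u) (v' * v) z := by
  change (mulRight₂ η u v ∘ₗ mulRight₂ η u' v') z = _
  congr 1
  exact BTensor.hom_ext fun x y => by simp [mul_assoc]

/-- The Takeuchi-Sweedler product `H ×_A H ⊆ H ⊗_A H`: all `∑ xᵢ ⊗ yᵢ` such that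
`∑ xᵢ t(aᵒ) ⊗ yᵢ = ∑ xᵢ ⊗ yᵢ s(a)` for all `a`. -/
def takeuchi : Submodule k (HTensor η H H) :=
  ⨅ a : A, LinearMap.eqLocus (mulRight₂ η (tgt η (MulOpposite.op a)) 1) (mulRight₂ η 1 (src η a))

theorem mem_takeuchi (z : HTensor η H H) : z ∈ takeuchi η ↔
    ∀ a : A, mulRight₂ η (tgt η (MulOpposite.op a)) 1 z = mulRight₂ η 1 (src η a) z := by
  simp [takeuchi, LinearMap.mem_eqLocus]

/-- Left multiplication by an element `∑ xᵢ ⊗ yᵢ` of the Takeuchi-Sweedler product,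
`u ⊗ v ↦ ∑ xᵢ u ⊗ yᵢ v`. On `H ×_A H` it is the multiplication of this algebra. -/
def takeuchiMul (z : takeuchi η) : HTensor η H H →ₗ[k] HTensor η H H :=
  BTensor.lift _ _
    (LinearMap.mk₂ k (fun u v => mulRight₂ η u v z.1)
      (fun u u' v => by
        rw [← LinearMap.add_apply]; congr 1
        exact BTensor.hom_ext fun x y => by simp [mul_add, BTensor.tmul_add_left])
      (fun c u v => by
        rw [← LinearMap.smul_apply]; congr 1
        exact BTensor.hom_ext fun x y => by simp [BTensor.tmul_smul_left])
      (fun u v v' => by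
        rw [← LinearMap.add_apply]; congr 1
        exact BTensor.hom_ext fun x y => by simp [mul_add, BTensor.tmul_add_right])
      (fun c u v => by
        rw [← LinearMap.smul_apply]; congr 1
        exact BTensor.hom_ext fun x y => by simp [BTensor.tmul_smul_right]))
    (fun u a v => by
      have h := congrArg (mulRight₂ η u v) ((mem_takeuchi η z.1).1 z.2 a)
      rw [mulRight₂_comp, mulRight₂_comp] at h
      simpa using h)

@[simp] theorem takeuchiMul_tmul (z : takeuchi η) (u v : H) :
    takeuchiMul η z (BTensor.tmul _ _ u v) = mulRight₂ η u v z.1 :=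
  BTensor.lift_tmul _ _ _ _ u v

end AeRing

/-! ### Left bialgebroids -/

/-- A left bialgebroid `(A, H)` over the field `k`. -/
structure LeftBialgebroid (k : Type uk) [Field k] (A : Type uA) [Ring A] [Algebra k A]
    (H : Type uH) [Ring H] [Algebra k H] where
  /-- the structure map from the enveloping algebra -/
  η : A ⊗[k] Aᵐᵒᵖ →ₐ[k] H
  /-- the comultiplication -/
  comul : H →ₗ[k] HTensor η H H
  /-- the counit -/
  counit : H →ₗ[k] A
  comul_src : ∀ a x, comul (srcAct η H a x) =
    BTensor.leftAct _ _ (srcAct η H) (tgtAct_srcAct η) a (comul x)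
  comul_tgt : ∀ a x, comul (tgtAct η H a x) =
    BTensor.rightAct _ _ (tgtAct η H) (tgtAct_srcAct η) a (comul x)
  counit_src : ∀ a x, counit (srcAct η H a x) = regLeft k A a (counit x)
  counit_tgt : ∀ a x, counit (tgtAct η H a x) = regRight k A a (counit x)
  /-- `(Δ ⊗ H) ∘ Δ = (H ⊗ Δ) ∘ Δ` in `(H ⊗_A H) ⊗_A H` -/
  coassoc : ∀ x,
    BTensor.map comul LinearMap.id comul_tgt (fun _ _ => rfl) (comul x) =
      BTensor.assocInv (tgtAct η H) (srcAct η H) (tgtAct η H) (srcAct η H) (tgtAct_srcAct η)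
        (BTensor.map LinearMap.id comul (fun _ _ => rfl) comul_src (comul x))
  /-- `(ε ⊗ H) ∘ Δ = id` -/
  counit_comul : ∀ x,
    lid (srcAct η H) (BTensor.map counit LinearMap.id counit_tgt (fun _ _ => rfl) (comul x)) = x
  /-- `(H ⊗ ε) ∘ Δ = id` -/
  comul_counit : ∀ x,
    rid (tgtAct η H) (BTensor.map LinearMap.id counit (fun _ _ => rfl) counit_src (comul x)) = x
  comul_mem : ∀ x, comul x ∈ takeuchi η
  comul_one : comul 1 = BTensor.tmul _ _ 1 1
  comul_mul : ∀ x y, comul (x * y) = takeuchiMul η ⟨comul x, comul_mem x⟩ (comul y)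
  counit_mul_src : ∀ x y, counit (x * src η (counit y)) = counit (x * y)
  counit_mul_tgt : ∀ x y, counit (x * tgt η (MulOpposite.op (counit y))) = counit (x * y)
  counit_one : counit 1 = 1

section Correspondence

variable {k : Type uk} [Field k] {A : Type uA} [Ring A] [Algebra k A]
  {H : Type uH} [Ring H] [Algebra k H] (𝓗 : LeftBialgebroid k A H)

/-- `N` is a two-sided coideal of `H`: it is an `A`-subbimodule, `Δ(N)` lies in the canonical image
of `N ⊗_A H + H ⊗_A N` in `H ⊗_A H`, and `ε(N) = 0`. -/
structure IsCoideal (N : Submodule k H) : Prop where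
  src_mem : ∀ a, ∀ x ∈ N, srcAct 𝓗.η H a x ∈ N
  tgt_mem : ∀ a, ∀ x ∈ N, tgtAct 𝓗.η H a x ∈ N
  comul_mem : ∀ x ∈ N, 𝓗.comul x ∈
    Submodule.span k {z : HTensor 𝓗.η H H | ∃ x ∈ N, ∃ y : H, z = BTensor.tmul _ _ x y} ⊔
    Submodule.span k {z : HTensor 𝓗.η H H | ∃ x : H, ∃ y ∈ N, z = BTensor.tmul _ _ x y}
  counit_eq_zero : ∀ x ∈ N, 𝓗.counit x = 0

/-- The left ideals of `H` that are two-sided coideals, ordered by inclusion. -/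
def LeftIdealCoideal : Type uH := {I : Ideal H // IsCoideal 𝓗 (I.restrictScalars k)}

instance : PartialOrder (LeftIdealCoideal 𝓗) :=
  inferInstanceAs (PartialOrder {I : Ideal H // IsCoideal 𝓗 (I.restrictScalars k)})

/-- `δ : M → M ⊗_A H` is a right `H`-comodule structure on the right `A`-module `(M, r)`: it is
right `A`-linear, coassociative and counital. -/
structure IsRightCoaction {M : Type uM} [AddCommGroup M] [Module k M] (r : RightAct k A M)
    (δ : M →ₗ[k] BTensor r (srcAct 𝓗.η H)) : Prop where
  linear : ∀ a m, δ (r a m) =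
    BTensor.rightAct r (srcAct 𝓗.η H) (tgtAct 𝓗.η H) (tgtAct_srcAct 𝓗.η) a (δ m)
  coassoc : ∀ m,
    BTensor.map δ LinearMap.id linear (fun _ _ => rfl) (δ m) =
      BTensor.assocInv r (srcAct 𝓗.η H) (tgtAct 𝓗.η H) (srcAct 𝓗.η H) (tgtAct_srcAct 𝓗.η)
        (BTensor.map LinearMap.id 𝓗.comul (fun _ _ => rfl) 𝓗.comul_src (δ m))
  counit : ∀ m,
    rid r (BTensor.map LinearMap.id 𝓗.counit (fun _ _ => rfl) 𝓗.counit_src (δ m)) = m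

/-- The right `A`-module structure `b · a = t(aᵒ) b` on a subalgebra `B` containing `t(Aᵒ)`. -/
def subAct (B : Subalgebra k H) (hB : ∀ a, tgt 𝓗.η a ∈ B) : RightAct k A B :=
  (Algebra.lmul k B).comp ((tgt 𝓗.η).codRestrict B hB)

/-- A right `H`-comodule `Aᵒ`-subring of `H` via `t`: a `k`-subalgebra `B` containing `t(Aᵒ)` that
admits a right `H`-coaction `δ` with `(ι ⊗_A H) ∘ δ = Δ ∘ ι`, where `ι : B → H` is the inclusion. -/
structure IsComoduleSubring (B : Subalgebra k H) : Prop where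
  tgt_mem : ∀ a, tgt 𝓗.η a ∈ B
  exists_coaction : ∃ δ : B →ₗ[k] BTensor (subAct 𝓗 B tgt_mem) (srcAct 𝓗.η H),
    IsRightCoaction 𝓗 (subAct 𝓗 B tgt_mem) δ ∧
    ∀ b : B, (BTensor.map B.val.toLinearMap LinearMap.id (fun _ _ => rfl) (fun _ _ => rfl) :
      BTensor (subAct 𝓗 B tgt_mem) (srcAct 𝓗.η H) →ₗ[k] HTensor 𝓗.η H H) (δ b) = 𝓗.comul b

/-- The right `H`-comodule `Aᵒ`-subrings of `H` via `t`, ordered by inclusion. -/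
def ComoduleSubring : Type uH := {B : Subalgebra k H // IsComoduleSubring 𝓗 B}

instance : PartialOrder (ComoduleSubring 𝓗) :=
  inferInstanceAs (PartialOrder {B : Subalgebra k H // IsComoduleSubring 𝓗 B})

/-- The left `H/I`-coaction `x ↦ ∑ π(x₁) ⊗ x₂` on `H`, where `π : H → H/I`. -/
def quotCoaction (I : Ideal H) : H →ₗ[k] HTensor 𝓗.η (H ⧸ I) H :=
  (BTensor.map (I.mkQ.restrictScalars k) LinearMap.id (fun _ _ => rfl) (fun _ _ => rfl) :
    HTensor 𝓗.η H H →ₗ[k] HTensor 𝓗.η (H ⧸ I) H) ∘ₗ 𝓗.comul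

/-- The coinvariants `{x | ∑ π(x₁) ⊗ x₂ = π(1) ⊗ x}`, where `π : H → H/I`. -/
def coinvariants (I : Ideal H) : Submodule k H :=
  LinearMap.eqLocus (quotCoaction 𝓗 I)
    (BTensor.mk (tgtAct 𝓗.η (H ⧸ I)) (srcAct 𝓗.η H) (I.mkQ 1))

/-- The left ideal `H B⁺`, where `B⁺ = B ∩ ker ε`. -/
def augIdeal (B : Subalgebra k H) : Ideal H :=
  Ideal.span {b : H | b ∈ B ∧ 𝓗.counit b = 0}

end Correspondence

end Bialgebroid

/-! Everything rests on describing the structures by images inside `H ⊗_A H`. By right exactness,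
`x` is coinvariant for `I` exactly when `Δ(x) - 1 ⊗ x` lies in the image of `I ⊗_A H`
(`mem_coinvariants_iff`).

Flatness enters twice. It makes `B ⊗_A H → H ⊗_A H` injective, so a subalgebra `B ⊇ t(Aᵒ)` is a
comodule subring as soon as `Δ(B)` lies in the image of `B ⊗_A H`
(`IsComoduleSubring.of_comul_mem`). It also makes `- ⊗_A H` commute with kernels. The coinvariants
are the kernel of the right `A`-linear map `φ(x) = ∑ π(x₁) ⊗ x₂ - π(1) ⊗ x`, and coassociativity
gives `(φ ⊗ H)(Δ(x)) = 0` for coinvariant `x`, so `Δ(x)` comes from coinvariants tensor `H`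
(`comul_mem_imLeft_coinvariants`).

For `b ∈ B`, counitality and the balancing relation give `Δ(b) - 1 ⊗ b = ∑ (b₁ - t(ε(b₁))) ⊗ b₂`,
which lies in the image of `HB⁺ ⊗_A H` (`IsComoduleSubring.comul_sub_mem`). Hence `HB⁺` is a
coideal, and `HB⁺ ⊆ I` forces `B` to be coinvariant. Conversely, `H ⊗ ε` applied to `Δ(b) - 1 ⊗ b`
returns `b - t(ε(b))`, which is `b` when `b ∈ B⁺`. This adjunction formally yields monotonicity and
the two triple identities.

Joins are sums of left ideals and generated subalgebras; a meet is the join of all lower bounds. -/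

namespace Bialgebroid

/-! ### Images of subspaces, associativity and right exactness for `⊗_A` -/

namespace BTensor

variable {k : Type uk} [Field k] {A : Type uA} [Ring A] [Algebra k A]
  {M : Type uM} [AddCommGroup M] [Module k M] {N : Type uN} [AddCommGroup N] [Module k N]
  {P : Type uP} [AddCommGroup P] [Module k P]
  {M' : Type uM'} [AddCommGroup M'] [Module k M']

theorem hom_ext_apply {r : RightAct k A M} {l : LeftAct k A N} (f g : BTensor r l →ₗ[k] P)
    (h : ∀ m n, f (tmul r l m n) = g (tmul r l m n)) (z : BTensor r l) : f z = g z :=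
  LinearMap.congr_fun (hom_ext h) z

/-- The canonical image of `S ⊗_A N` in `M ⊗_A N`, for a subspace `S` of `M`. -/
def imLeft (r : RightAct k A M) (l : LeftAct k A N) (S : Submodule k M) :
    Submodule k (BTensor r l) :=
  Submodule.span k {z | ∃ x ∈ S, ∃ y : N, z = tmul r l x y}

/-- The canonical image of `M ⊗_A S` in `M ⊗_A N`, for a subspace `S` of `N`. -/
def imRight (r : RightAct k A M) (l : LeftAct k A N) (S : Submodule k N) :
    Submodule k (BTensor r l) :=
  Submodule.span k {z | ∃ x : M, ∃ y ∈ S, z = tmul r l x y}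

variable {r : RightAct k A M} {l : LeftAct k A N}

theorem tmul_mem_imLeft {S : Submodule k M} {x : M} (hx : x ∈ S) (y : N) :
    tmul r l x y ∈ imLeft r l S :=
  Submodule.subset_span ⟨x, hx, y, rfl⟩

theorem tmul_mem_imRight {S : Submodule k N} (x : M) {y : N} (hy : y ∈ S) :
    tmul r l x y ∈ imRight r l S :=
  Submodule.subset_span ⟨x, y, hy, rfl⟩

theorem imLeft_le {S : Submodule k M} {T : Submodule k (BTensor r l)}
    (h : ∀ x ∈ S, ∀ y, tmul r l x y ∈ T) : imLeft r l S ≤ T := by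
  rw [imLeft, Submodule.span_le]
  rintro _ ⟨x, hx, y, rfl⟩
  exact h x hx y

theorem imRight_le {S : Submodule k N} {T : Submodule k (BTensor r l)}
    (h : ∀ x, ∀ y ∈ S, tmul r l x y ∈ T) : imRight r l S ≤ T := by
  rw [imRight, Submodule.span_le]
  rintro _ ⟨x, y, hy, rfl⟩
  exact h x y hy

theorem imLeft_mono {S T : Submodule k M} (h : S ≤ T) : imLeft r l S ≤ imLeft r l T :=
  imLeft_le fun _ hx y => tmul_mem_imLeft (h hx) y

theorem imRight_mono {S T : Submodule k N} (h : S ≤ T) : imRight r l S ≤ imRight r l T :=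
  imRight_le fun x _ hy => tmul_mem_imRight x (h hy)

theorem mem_imLeft_top (z : BTensor r l) : z ∈ imLeft r l ⊤ := by
  have h : (imLeft r l ⊤).mkQ z = (0 : BTensor r l →ₗ[k] _) z :=
    hom_ext_apply (imLeft r l ⊤).mkQ 0 (fun m n => by
      simpa using tmul_mem_imLeft (Submodule.mem_top) n) z
  simpa using h

theorem mem_imRight_top (z : BTensor r l) : z ∈ imRight r l ⊤ :=
  imLeft_le (fun x _ _ => tmul_mem_imRight x Submodule.mem_top) (mem_imLeft_top z)

section Naturality

variable {r' : RightAct k A M'} {lN : LeftAct k A N} {rN : RightAct k A N} {lP : LeftAct k A P}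
  (h : ∀ a b n, rN b (lN a n) = lN a (rN b n))

theorem map_rightAct (f : M →ₗ[k] M') (hf : ∀ a m, f (r a m) = r' a (f m)) (a : Aᵐᵒᵖ)
    (z : BTensor r lN) :
    (map f LinearMap.id hf (fun _ _ => rfl) : BTensor r lN →ₗ[k] BTensor r' lN)
      (rightAct r lN rN h a z) =
    rightAct r' lN rN h a (map f LinearMap.id hf (fun _ _ => rfl) z) :=
  hom_ext_apply (map f LinearMap.id hf (fun _ _ => rfl) ∘ₗ rightAct r lN rN h a)
    (rightAct r' lN rN h a ∘ₗ map f LinearMap.id hf (fun _ _ => rfl)) (fun _ _ => rfl) z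

/-- Carries coassociativity of `Δ` along the inclusion `B → H` and along the projection `H → H/I`.
-/
theorem assocInv_naturality (f : M →ₗ[k] M') (hf : ∀ a m, f (r a m) = r' a (f m))
    (z : BTensor r (leftAct rN lP lN h)) :
    (map (map f LinearMap.id hf (fun _ _ => rfl)) LinearMap.id (map_rightAct h f hf)
        (fun _ _ => rfl) :
      BTensor (rightAct r lN rN h) lP →ₗ[k] BTensor (rightAct r' lN rN h) lP)
      (assocInv r lN rN lP h z) =
    assocInv r' lN rN lP h (map f LinearMap.id hf (fun _ _ => rfl) z) := by
  let α := assocInv r lN rN lP h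
  let α' := assocInv r' lN rN lP h
  let F : BTensor (rightAct r lN rN h) lP →ₗ[k] BTensor (rightAct r' lN rN h) lP :=
    map (map f LinearMap.id hf (fun _ _ => rfl)) LinearMap.id (map_rightAct h f hf)
      (fun _ _ => rfl)
  let G : BTensor r (leftAct rN lP lN h) →ₗ[k] BTensor r' (leftAct rN lP lN h) :=
    map f LinearMap.id hf (fun _ _ => rfl)
  refine hom_ext_apply (F ∘ₗ α) (α' ∘ₗ G) (fun m w => ?_) z
  exact hom_ext_apply (F ∘ₗ assocAux r lN rN lP h m) (assocAux r' lN rN lP h (f m))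
    (fun n p => rfl) w

end Naturality

/-- Right exactness: the kernel of `f ⊗_A N` for surjective `f` is the image of `ker f ⊗_A N`. -/
theorem mem_imLeft_of_map_eq_zero {r' : RightAct k A M'} (f : M →ₗ[k] M')
    (hf : ∀ a m, f (r a m) = r' a (f m)) (hs : Function.Surjective f) {z : BTensor r l}
    (hz : (map f LinearMap.id hf (fun _ _ => rfl) : BTensor r l →ₗ[k] BTensor r' l) z = 0) :
    z ∈ imLeft r l (LinearMap.ker f) := by
  let Q := imLeft r l (LinearMap.ker f)
  let g : M →ₗ[k] N →ₗ[k] (BTensor r l ⧸ Q) := (mk r l).compr₂ Q.mkQ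
  have hg : LinearMap.ker f ≤ LinearMap.ker g := fun m hm => by
    rw [LinearMap.mem_ker]
    ext n
    simpa [g] using (Submodule.Quotient.mk_eq_zero Q).2 (tmul_mem_imLeft hm n)
  -- Pure tensors with left factor in `ker f` vanish modulo `Q`, so `m' ⊗ n` can be sent to the
  -- class of `m ⊗ n` for any preimage `m` of `m'`. The resulting `G` satisfies `G ∘ (f ⊗ N) =
  -- Q.mkQ`.
  let g' : M' →ₗ[k] N →ₗ[k] (BTensor r l ⧸ Q) :=
    (LinearMap.ker f).liftQ g hg ∘ₗ (f.quotKerEquivOfSurjective hs).symm.toLinearMap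
  have hg' : ∀ m, g' (f m) = g m := fun m => by
    have : (f.quotKerEquivOfSurjective hs).symm (f m) = (LinearMap.ker f).mkQ m := by
      rw [LinearEquiv.symm_apply_eq]; rfl
    simp [g', this]
  let G : BTensor r' l →ₗ[k] (BTensor r l ⧸ Q) := lift r' l g' fun m' a n => by
    obtain ⟨m, rfl⟩ := hs m'
    rw [← hf, hg', hg']
    simp [g, tmul_act]
  have hG := hom_ext_apply (G ∘ₗ map f LinearMap.id hf (fun _ _ => rfl)) Q.mkQ
    (fun m n => by
      rw [LinearMap.comp_apply, map_tmul, lift_tmul, hg']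
      rfl) z
  rw [LinearMap.comp_apply, hz, map_zero] at hG
  exact (Submodule.Quotient.mk_eq_zero Q).1 hG.symm

/-- The restriction of a right action to an invariant subspace. -/
def restrictAct (r : RightAct k A M) (S : Submodule k M) (h : ∀ a, ∀ m ∈ S, r a m ∈ S) :
    RightAct k A S where
  toFun a := (r a).restrict (h a)
  map_one' := by ext; simp
  map_mul' a b := by ext; simp
  map_zero' := by ext; simp
  map_add' a b := by ext; simp
  commutes' c := by ext x; simp only [AlgHom.commutes]; rfl

/-- The right action on a universe lift. -/
def uliftAct (r : RightAct k A M) : RightAct k A (ULift.{uP} M) where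
  toFun a := ULift.moduleEquiv.symm.toLinearMap ∘ₗ r a ∘ₗ ULift.moduleEquiv.toLinearMap
  map_one' := by ext; simp
  map_mul' a b := by ext; simp
  map_zero' := by ext; simp
  map_add' a b := by ext; simp
  commutes' c := by ext x; simp only [AlgHom.commutes]; rfl

end BTensor

/-! ### Exactness of `- ⊗_A N` for flat `N` -/

namespace IsFlat

open BTensor

variable {k : Type uk} [Field k] {A : Type uA} [Ring A] [Algebra k A]
  {N : Type uN} [AddCommGroup N] [Module k N] {l : LeftAct k A N}
  {M : Type uN} [AddCommGroup M] [Module k M] {M' : Type uN} [AddCommGroup M'] [Module k M']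
  {r : RightAct k A M} {r' : RightAct k A M'}

/-- `IsFlat` tests modules in the universe `max uA uN`; lifting both modules there reaches those
that live in `uN`. -/
theorem map_injective (h : IsFlat l) (f : M →ₗ[k] M') (hf : ∀ a m, f (r a m) = r' a (f m))
    (hi : Function.Injective f) : Function.Injective
      (map f LinearMap.id hf (fun _ _ => rfl) : BTensor r l →ₗ[k] BTensor r' l) := by
  let F : ULift.{uA} M →ₗ[k] ULift.{uA} M' :=
    ULift.moduleEquiv.symm.toLinearMap ∘ₗ f ∘ₗ ULift.moduleEquiv.toLinearMap
  have hF : ∀ a m, F (uliftAct r a m) = uliftAct r' a (F m) := fun a m => by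
    simp [F, uliftAct, hf]
  have hFi : Function.Injective F := fun x y hxy => by
    have := congrArg ULift.down hxy
    exact ULift.ext _ _ (hi this)
  have key := h (ULift.{uA} M) (ULift.{uA} M') (uliftAct r) (uliftAct r') F hF hFi
  let up : BTensor r l →ₗ[k] BTensor (uliftAct.{uk, uA, uN, uA} r) l :=
    map ULift.moduleEquiv.symm.toLinearMap LinearMap.id (fun _ _ => rfl) (fun _ _ => rfl)
  let up' : BTensor r' l →ₗ[k] BTensor (uliftAct.{uk, uA, uN, uA} r') l :=
    map ULift.moduleEquiv.symm.toLinearMap LinearMap.id (fun _ _ => rfl) (fun _ _ => rfl)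
  let down : BTensor (uliftAct.{uk, uA, uN, uA} r) l →ₗ[k] BTensor r l :=
    map ULift.moduleEquiv.toLinearMap LinearMap.id (fun _ _ => rfl) (fun _ _ => rfl)
  have hdu : ∀ z, down (up z) = z :=
    hom_ext_apply (down ∘ₗ up) LinearMap.id fun m n => rfl
  have hup : ∀ z, map F LinearMap.id hF (fun _ _ => rfl) (up z) =
      up' (map f LinearMap.id hf (fun _ _ => rfl) z) :=
    hom_ext_apply (map F LinearMap.id hF (fun _ _ => rfl) ∘ₗ up)
      (up' ∘ₗ map f LinearMap.id hf (fun _ _ => rfl)) fun m n => rfl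
  intro z w hzw
  rw [← hdu z, ← hdu w]
  congr 1
  apply key
  rw [hup, hup, hzw]

/-- Factor `f` through its range: flatness keeps the inclusion of the range injective, and right
exactness handles the surjection onto the range. -/
theorem mem_imLeft_of_map_eq_zero (h : IsFlat l) (f : M →ₗ[k] M')
    (hf : ∀ a m, f (r a m) = r' a (f m)) {z : BTensor r l}
    (hz : (map f LinearMap.id hf (fun _ _ => rfl) : BTensor r l →ₗ[k] BTensor r' l) z = 0) :
    z ∈ imLeft r l (LinearMap.ker f) := by
  let ρ := restrictAct r' (LinearMap.range f) (by
    rintro a _ ⟨m, rfl⟩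
    exact ⟨r a m, hf a m⟩)
  have hf₁ : ∀ a m, f.rangeRestrict (r a m) = ρ a (f.rangeRestrict m) := fun a m =>
    Subtype.ext (hf a m)
  have hf₂ : ∀ a m, (LinearMap.range f).subtype (ρ a m) = r' a ((LinearMap.range f).subtype m) :=
    fun a m => rfl
  have hz' : map f.rangeRestrict LinearMap.id hf₁ (fun _ _ => rfl) z =
      (0 : BTensor ρ l) := by
    apply h.map_injective _ hf₂ Subtype.val_injective
    rw [map_zero, ← hz]
    exact hom_ext_apply ((map _ LinearMap.id hf₂ (fun _ _ => rfl) :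
      BTensor ρ l →ₗ[k] BTensor r' l) ∘ₗ map f.rangeRestrict LinearMap.id hf₁ (fun _ _ => rfl))
      (map f LinearMap.id hf (fun _ _ => rfl)) (fun m n => by simp) z
  have := BTensor.mem_imLeft_of_map_eq_zero f.rangeRestrict hf₁ f.surjective_rangeRestrict hz'
  rwa [LinearMap.ker_rangeRestrict] at this

end IsFlat

end Bialgebroid

/-! ### Multiplication and images of left ideals -/

namespace Bialgebroid

open BTensor

section Takeuchi

variable {k : Type uk} [Field k] {A : Type uA} [Ring A] [Algebra k A]
  {H : Type uH} [Ring H] [Algebra k H] {η : A ⊗[k] Aᵐᵒᵖ →ₐ[k] H}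

/-- Right multiplication by `u ⊗ v` maps the image of `S ⊗_A H` to that of `T ⊗_A H` when
`S u ⊆ T`. -/
theorem mulRight₂_mem_imLeft {S T : Submodule k H} {u : H} (hu : ∀ x ∈ S, x * u ∈ T) (v : H)
    {z : HTensor η H H} (hz : z ∈ imLeft _ _ S) : mulRight₂ η u v z ∈ imLeft _ _ T := by
  refine (imLeft_le (T := (imLeft _ _ T).comap (mulRight₂ η u v)) fun x hx y => ?_) hz
  rw [Submodule.mem_comap, mulRight₂_tmul]
  exact tmul_mem_imLeft (hu x hx) _

theorem mulRight₂_mem_imRight {S T : Submodule k H} (u : H) {v : H} (hv : ∀ x ∈ S, x * v ∈ T)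
    {z : HTensor η H H} (hz : z ∈ imRight _ _ S) : mulRight₂ η u v z ∈ imRight _ _ T := by
  refine (imRight_le (T := (imRight _ _ T).comap (mulRight₂ η u v)) fun x y hy => ?_) hz
  rw [Submodule.mem_comap, mulRight₂_tmul]
  exact tmul_mem_imRight _ (hv y hy)

/-- With `w = ∑ xᵢ ⊗ yᵢ`, the product `∑ xᵢ u ⊗ yᵢ v` multiplies `u ∈ I` on the left only, so no
right-ideal property is needed. -/
theorem takeuchiMul_mem_imLeft (I : Ideal H) (w : takeuchi η) {z : HTensor η H H}
    (hz : z ∈ imLeft _ _ (I.restrictScalars k)) :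
    takeuchiMul η w z ∈ imLeft _ _ (I.restrictScalars k) := by
  refine (imLeft_le (T := (imLeft _ _ (I.restrictScalars k)).comap (takeuchiMul η w))
    fun x hx y => ?_) hz
  rw [Submodule.mem_comap, takeuchiMul_tmul]
  exact mulRight₂_mem_imLeft (S := ⊤) (fun a _ => I.mul_mem_left a hx) _
    (mem_imLeft_top _)

theorem takeuchiMul_mem_imRight (I : Ideal H) (w : takeuchi η) {z : HTensor η H H}
    (hz : z ∈ imRight _ _ (I.restrictScalars k)) :
    takeuchiMul η w z ∈ imRight _ _ (I.restrictScalars k) := by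
  refine (imRight_le (T := (imRight _ _ (I.restrictScalars k)).comap (takeuchiMul η w))
    fun x y hy => ?_) hz
  rw [Submodule.mem_comap, takeuchiMul_tmul]
  exact mulRight₂_mem_imRight (S := ⊤) _ (fun a _ => I.mul_mem_left a hy)
    (mem_imRight_top _)

end Takeuchi

/-! ### Consequences of the counit axioms -/

section Correspondence

variable {k : Type uk} [Field k] {A : Type uA} [Ring A] [Algebra k A]
  {H : Type uH} [Ring H] [Algebra k H] (𝓗 : LeftBialgebroid k A H)

theorem comul_tgt_apply (a : Aᵐᵒᵖ) : 𝓗.comul (tgt 𝓗.η a) = tmul _ _ 1 (tgt 𝓗.η a) := by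
  have h := 𝓗.comul_tgt a 1
  rw [𝓗.comul_one, rightAct_tmul] at h
  simpa using h

theorem counit_tgt_apply (a : Aᵐᵒᵖ) : 𝓗.counit (tgt 𝓗.η a) = a.unop := by
  have h := 𝓗.counit_tgt a 1
  rw [𝓗.counit_one] at h
  simpa using h

/-- The map `x ⊗ y ↦ t(ε(y)) x`. -/
def counitRight : HTensor 𝓗.η H H →ₗ[k] H :=
  rid (tgtAct 𝓗.η H) ∘ₗ map LinearMap.id 𝓗.counit (fun _ _ => rfl) 𝓗.counit_src

theorem counitRight_tmul (x y : H) :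
    counitRight 𝓗 (tmul _ _ x y) = tgt 𝓗.η (MulOpposite.op (𝓗.counit y)) * x := by
  rw [counitRight, LinearMap.comp_apply, map_tmul, rid_tmul]
  rfl

theorem counitRight_comul (x : H) : counitRight 𝓗 (𝓗.comul x) = x := 𝓗.comul_counit x

/-- The map `x ⊗ y ↦ s(ε(x)) y`. -/
def counitLeft : HTensor 𝓗.η H H →ₗ[k] H :=
  lid (srcAct 𝓗.η H) ∘ₗ map 𝓗.counit LinearMap.id 𝓗.counit_tgt (fun _ _ => rfl)

theorem counitLeft_tmul (x y : H) :
    counitLeft 𝓗 (tmul _ _ x y) = src 𝓗.η (𝓗.counit x) * y := by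
  rw [counitLeft, LinearMap.comp_apply, map_tmul, lid_tmul]
  rfl

theorem counitLeft_comul (x : H) : counitLeft 𝓗 (𝓗.comul x) = x := 𝓗.counit_comul x

/-! ### Comodule subrings -/

section Subring

variable {𝓗}

theorem IsComoduleSubring.comul_mem_imLeft {B : Subalgebra k H} (hB : IsComoduleSubring 𝓗 B)
    {b : H} (hb : b ∈ B) : 𝓗.comul b ∈ imLeft _ _ (Subalgebra.toSubmodule B) := by
  obtain ⟨δ, -, hδ⟩ := hB.exists_coaction
  have h := hδ ⟨b, hb⟩
  rw [← h]
  refine (imLeft_le (S := ⊤) (T := (imLeft _ _ (Subalgebra.toSubmodule B)).comap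
    (map B.val.toLinearMap LinearMap.id (fun _ _ => rfl) (fun _ _ => rfl) :
      BTensor (subAct 𝓗 B hB.tgt_mem) (srcAct 𝓗.η H) →ₗ[k] HTensor 𝓗.η H H))
    fun x _ y => ?_) (mem_imLeft_top _)
  exact tmul_mem_imLeft (S := Subalgebra.toSubmodule B) x.2 y

/-- Over a flat bialgebroid, the coaction of a comodule subring is determined by its
existence: it suffices that `Δ(B)` lies in the image of `B ⊗_A H`. -/
theorem IsComoduleSubring.of_comul_mem (hflat : IsFlat (srcAct 𝓗.η H)) {B : Subalgebra k H}
    (ht : ∀ a, tgt 𝓗.η a ∈ B)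
    (hB : ∀ b ∈ B, 𝓗.comul b ∈ imLeft _ _ (Subalgebra.toSubmodule B)) :
    IsComoduleSubring 𝓗 B := by
  refine ⟨ht, ?_⟩
  have hι : ∀ a m, B.val.toLinearMap (subAct 𝓗 B ht a m) =
    tgtAct 𝓗.η H a (B.val.toLinearMap m) := fun _ _ => rfl
  let j : BTensor (subAct 𝓗 B ht) (srcAct 𝓗.η H) →ₗ[k] HTensor 𝓗.η H H :=
    map B.val.toLinearMap LinearMap.id hι (fun _ _ => rfl)
  have hj : Function.Injective j := hflat.map_injective _ hι Subtype.val_injective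
  have hrange : imLeft _ _ (Subalgebra.toSubmodule B) ≤ LinearMap.range j :=
    imLeft_le fun x hx y => ⟨tmul _ _ ⟨x, hx⟩ y, map_tmul _ _ _ _ _ _⟩
  -- The coaction is forced: it is `Δ` restricted to `B`, pulled back along the injection `j`.
  let δ : B →ₗ[k] BTensor (subAct 𝓗 B ht) (srcAct 𝓗.η H) :=
    (LinearEquiv.ofInjective j hj).symm.toLinearMap ∘ₗ
      (𝓗.comul ∘ₗ B.val.toLinearMap).codRestrict (LinearMap.range j)
        (fun b => hrange (hB b b.2))
  have hδ : ∀ b : B, j (δ b) = 𝓗.comul b := fun b =>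
    congrArg Subtype.val ((LinearEquiv.ofInjective j hj).apply_symm_apply
      ((𝓗.comul ∘ₗ B.val.toLinearMap).codRestrict (LinearMap.range j)
        (fun b => hrange (hB b b.2)) b))
  have hjr := map_rightAct (lN := srcAct 𝓗.η H) (tgtAct_srcAct (M := H) 𝓗.η) _ hι
  have hlin : ∀ a m, δ (subAct 𝓗 B ht a m) = rightAct (subAct 𝓗 B ht) (srcAct 𝓗.η H)
      (tgtAct 𝓗.η H) (tgtAct_srcAct 𝓗.η) a (δ m) := fun a m => hj <| by
    rw [hjr, hδ, hδ]
    exact 𝓗.comul_tgt a m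
  refine ⟨δ, ⟨hlin, fun b => ?_, fun b => Subtype.val_injective ?_⟩, hδ⟩
  -- Tensoring `j` with `H` once more stays injective, so coassociativity of `δ` can be tested in
  -- `(H ⊗_A H) ⊗_A H`, where it is that of `Δ`.
  · apply hflat.map_injective j hjr hj
    have h₁ : ∀ z, map j LinearMap.id hjr (fun _ _ => rfl)
        (map δ LinearMap.id hlin (fun _ _ => rfl) z) =
        map 𝓗.comul LinearMap.id 𝓗.comul_tgt (fun _ _ => rfl) (j z) :=
      hom_ext_apply (map j LinearMap.id hjr (fun _ _ => rfl) ∘ₗ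
          map δ LinearMap.id hlin (fun _ _ => rfl))
        (map 𝓗.comul LinearMap.id 𝓗.comul_tgt (fun _ _ => rfl) ∘ₗ j)
        fun m n => congrArg (fun x => tmul _ _ x n) (hδ m)
    have h₃ : ∀ z, map B.val.toLinearMap LinearMap.id hι (fun _ _ => rfl)
        (map LinearMap.id 𝓗.comul (fun _ _ => rfl) 𝓗.comul_src z) =
        map LinearMap.id 𝓗.comul (fun _ _ => rfl) 𝓗.comul_src (j z) :=
      hom_ext_apply (map B.val.toLinearMap LinearMap.id hι (fun _ _ => rfl) ∘ₗ
          map LinearMap.id 𝓗.comul (fun _ _ => rfl) 𝓗.comul_src)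
        (map LinearMap.id 𝓗.comul (fun _ _ => rfl) 𝓗.comul_src ∘ₗ j) fun m n => rfl
    refine (h₁ _).trans (Eq.trans ?_ (assocInv_naturality _ _ hι _).symm)
    rw [h₃, hδ]
    exact 𝓗.coassoc b
  · have h : ∀ z, B.val.toLinearMap (rid (subAct 𝓗 B ht)
        (map LinearMap.id 𝓗.counit (fun _ _ => rfl) 𝓗.counit_src z)) =
        counitRight 𝓗 (j z) :=
      hom_ext_apply (B.val.toLinearMap ∘ₗ rid (subAct 𝓗 B ht) ∘ₗ
          map LinearMap.id 𝓗.counit (fun _ _ => rfl) 𝓗.counit_src) (counitRight 𝓗 ∘ₗ j)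
        fun m n => rfl
    refine (h _).trans ?_
    rw [hδ, counitRight_comul]

end Subring

end Correspondence

end Bialgebroid

namespace Bialgebroid

open BTensor

section Correspondence

variable {k : Type uk} [Field k] {A : Type uA} [Ring A] [Algebra k A]
  {H : Type uH} [Ring H] [Algebra k H] (𝓗 : LeftBialgebroid k A H)

/-! ### Coinvariants -/

theorem map_mkQ_eq_zero_iff (η : A ⊗[k] Aᵐᵒᵖ →ₐ[k] H) (I : Ideal H) (z : HTensor η H H) :
    (map (I.mkQ.restrictScalars k) LinearMap.id (fun _ _ => rfl) (fun _ _ => rfl) :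
      HTensor η H H →ₗ[k] HTensor η (H ⧸ I) H) z = 0 ↔
    z ∈ imLeft _ _ (I.restrictScalars k) := by
  constructor
  · intro hz
    have h := mem_imLeft_of_map_eq_zero (r := tgtAct η H) (r' := tgtAct η (H ⧸ I))
      (I.mkQ.restrictScalars k) (fun _ _ => rfl) I.mkQ_surjective hz
    refine imLeft_mono (fun x hx => ?_) h
    exact (Submodule.Quotient.mk_eq_zero I).1 hx
  · refine fun hz => imLeft_le (T := LinearMap.ker
      (map (I.mkQ.restrictScalars k) LinearMap.id (fun _ _ => rfl) (fun _ _ => rfl) :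
        HTensor η H H →ₗ[k] HTensor η (H ⧸ I) H)) (fun x hx y => ?_) hz
    change tmul (tgtAct η (H ⧸ I)) (srcAct η H) (I.mkQ x) y = 0
    rw [show I.mkQ x = 0 from (Submodule.Quotient.mk_eq_zero I).2 hx, zero_tmul]

theorem mem_coinvariants_iff (I : Ideal H) (x : H) : x ∈ coinvariants 𝓗 I ↔
    𝓗.comul x - tmul _ _ 1 x ∈ imLeft (tgtAct 𝓗.η H) (srcAct 𝓗.η H) (I.restrictScalars k) := by
  rw [← map_mkQ_eq_zero_iff, map_sub, sub_eq_zero]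
  exact Iff.rfl

theorem one_mem_coinvariants (I : Ideal H) : 1 ∈ coinvariants 𝓗 I := by
  rw [mem_coinvariants_iff, 𝓗.comul_one, sub_self]
  exact Submodule.zero_mem _

theorem tgt_mem_coinvariants (I : Ideal H) (a : Aᵐᵒᵖ) : tgt 𝓗.η a ∈ coinvariants 𝓗 I := by
  rw [mem_coinvariants_iff, comul_tgt_apply, sub_self]
  exact Submodule.zero_mem _

theorem mul_mem_coinvariants (I : Ideal H) (x y : H) (hx : x ∈ coinvariants 𝓗 I)
    (hy : y ∈ coinvariants 𝓗 I) : x * y ∈ coinvariants 𝓗 I := by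
  rw [mem_coinvariants_iff] at hx hy ⊢
  -- `Δ(xy) - 1 ⊗ xy = Δ(x)(Δ(y) - 1 ⊗ y) + (Δ(x) - 1 ⊗ x)(1 ⊗ y)`; the second summand is safe
  -- because its left factors are multiplied only by `1`.
  have h₁ := takeuchiMul_mem_imLeft I ⟨𝓗.comul x, 𝓗.comul_mem x⟩ hy
  have h₂ := mulRight₂_mem_imLeft (u := 1) (fun z hz => (mul_one z).symm ▸ hz) y hx
  rw [map_sub, ← 𝓗.comul_mul, takeuchiMul_tmul] at h₁
  rw [map_sub, mulRight₂_tmul, one_mul] at h₂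
  simpa using add_mem h₁ h₂

/-- The coinvariants as a subalgebra. -/
def coinvariantSubalgebra (I : Ideal H) : Subalgebra k H :=
  (coinvariants 𝓗 I).toSubalgebra (one_mem_coinvariants 𝓗 I) (mul_mem_coinvariants 𝓗 I)

variable {𝓗}

/-- Over a flat bialgebroid, `Δ` maps the coinvariants `N` to the image of `N ⊗_A H`. -/
theorem comul_mem_imLeft_coinvariants (hflat : IsFlat (srcAct 𝓗.η H)) (I : Ideal H) {x : H}
    (hx : x ∈ coinvariants 𝓗 I) : 𝓗.comul x ∈ imLeft _ _ (coinvariants 𝓗 I) := by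
  let ρ := rightAct (tgtAct 𝓗.η (H ⧸ I)) (srcAct 𝓗.η H) (tgtAct 𝓗.η H) (tgtAct_srcAct 𝓗.η)
  let q : HTensor 𝓗.η H H →ₗ[k] HTensor 𝓗.η (H ⧸ I) H :=
    map (I.mkQ.restrictScalars k) LinearMap.id (fun _ _ => rfl) (fun _ _ => rfl)
  let U : H →ₗ[k] HTensor 𝓗.η (H ⧸ I) H := BTensor.mk _ _ (I.mkQ 1)
  have hq := map_rightAct (r := tgtAct 𝓗.η H) (r' := tgtAct 𝓗.η (H ⧸ I)) (lN := srcAct 𝓗.η H)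
    (tgtAct_srcAct (M := H) 𝓗.η) (I.mkQ.restrictScalars k) (fun _ _ => rfl)
  have hQ : ∀ a y, quotCoaction 𝓗 I (tgtAct 𝓗.η H a y) = ρ a (quotCoaction 𝓗 I y) :=
    fun a y => (congrArg q (𝓗.comul_tgt a y)).trans (hq a _)
  have hU : ∀ a y, U (tgtAct 𝓗.η H a y) = ρ a (U y) := fun a y => rfl
  have hφ : ∀ a y, (quotCoaction 𝓗 I - U) (tgtAct 𝓗.η H a y) =
      ρ a ((quotCoaction 𝓗 I - U) y) := fun a y => by
    rw [LinearMap.sub_apply, LinearMap.sub_apply, hQ, hU, map_sub]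
  -- Flatness reduces the claim to showing that this map, tensored with `H`, kills `Δ(x)`.
  have hker : LinearMap.ker (quotCoaction 𝓗 I - U) = coinvariants 𝓗 I := by
    ext y
    rw [LinearMap.mem_ker, LinearMap.sub_apply, sub_eq_zero]
    exact Iff.rfl
  rw [← hker]
  refine hflat.mem_imLeft_of_map_eq_zero _ hφ ?_
  let F : HTensor 𝓗.η H H →ₗ[k] BTensor ρ (srcAct 𝓗.η H) :=
    map (quotCoaction 𝓗 I) LinearMap.id hQ (fun _ _ => rfl)
  let G : HTensor 𝓗.η H H →ₗ[k] BTensor ρ (srcAct 𝓗.η H) :=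
    map U LinearMap.id hU (fun _ _ => rfl)
  have h₁ : ∀ z, map (quotCoaction 𝓗 I - U) LinearMap.id hφ (fun _ _ => rfl) z = (F - G) z :=
    hom_ext_apply (map (quotCoaction 𝓗 I - U) LinearMap.id hφ (fun _ _ => rfl)) (F - G)
      fun m n => ((BTensor.mk ρ (srcAct 𝓗.η H)).flip n).map_sub (quotCoaction 𝓗 I m) (U m)
  have h₂ : ∀ z, F z = map q LinearMap.id hq (fun _ _ => rfl)
      (map 𝓗.comul LinearMap.id 𝓗.comul_tgt (fun _ _ => rfl) z) :=
    hom_ext_apply F (map q LinearMap.id hq (fun _ _ => rfl) ∘ₗ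
      map 𝓗.comul LinearMap.id 𝓗.comul_tgt (fun _ _ => rfl)) fun m n => rfl
  let K : HTensor 𝓗.η H H →ₗ[k] BTensor (tgtAct 𝓗.η H)
      (leftAct (tgtAct 𝓗.η H) (srcAct 𝓗.η H) (srcAct 𝓗.η H) (tgtAct_srcAct 𝓗.η)) :=
    map LinearMap.id 𝓗.comul (fun _ _ => rfl) 𝓗.comul_src
  let K' : HTensor 𝓗.η (H ⧸ I) H →ₗ[k] BTensor (tgtAct 𝓗.η (H ⧸ I))
      (leftAct (tgtAct 𝓗.η H) (srcAct 𝓗.η H) (srcAct 𝓗.η H) (tgtAct_srcAct 𝓗.η)) :=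
    map LinearMap.id 𝓗.comul (fun _ _ => rfl) 𝓗.comul_src
  have h₃ : ∀ z, map (I.mkQ.restrictScalars k) LinearMap.id (fun _ _ => rfl) (fun _ _ => rfl)
      (K z) = K' (q z) :=
    hom_ext_apply (map (I.mkQ.restrictScalars k) LinearMap.id (fun _ _ => rfl)
      (fun _ _ => rfl) ∘ₗ K) (K' ∘ₗ q) fun m n => rfl
  -- By coassociativity and naturality, `F(Δ(x))` is `H/I ⊗ Δ` applied to `∑ π(x₁) ⊗ x₂`, up to
  -- reassociation. Coinvariance replaces the argument by `π(1) ⊗ x`, leaving `∑ (π(1) ⊗ x₁) ⊗ x₂ =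
  -- G(Δ(x))`.
  have h₄ : F (𝓗.comul x) = G (𝓗.comul x) := by
    rw [h₂, 𝓗.coassoc]
    refine (assocInv_naturality _ _ _ _).trans ?_
    refine (congrArg _ (h₃ _)).trans ?_
    have hqx : q (𝓗.comul x) = U x := hx
    rw [hqx]
    rfl
  rw [h₁, LinearMap.sub_apply, h₄, sub_self]

theorem isComoduleSubring_coinvariantSubalgebra (hflat : IsFlat (srcAct 𝓗.η H)) (I : Ideal H) :
    IsComoduleSubring 𝓗 (coinvariantSubalgebra 𝓗 I) :=
  .of_comul_mem hflat (tgt_mem_coinvariants 𝓗 I)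
    fun _ hb => comul_mem_imLeft_coinvariants hflat I hb

/-! ### The left ideal generated by the augmentation ideal -/

theorem counit_eq_zero_of_mem_augIdeal (B : Subalgebra k H) {x : H} (hx : x ∈ augIdeal 𝓗 B) :
    𝓗.counit x = 0 := by
  rw [augIdeal] at hx
  induction hx using Submodule.span_induction with
  | mem x hx => exact hx.2
  | zero => exact map_zero _
  | add x y _ _ hx hy => rw [map_add, hx, hy, add_zero]
  -- `ε(ax) = ε(a s(ε(x)))` makes `ker ε` a left ideal.
  | smul a x _ hx => rw [smul_eq_mul, ← 𝓗.counit_mul_src, hx, map_zero, mul_zero, map_zero]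

/-- Since `1 ⊗ b = ∑ 1 ⊗ s(ε(b₁)) b₂ = ∑ t(ε(b₁)) ⊗ b₂`, the difference is `∑ (b₁ - t(ε(b₁))) ⊗ b₂`.
The left factors lie in `B⁺` because the `b₁` may be chosen in `B`, `t(Aᵒ) ⊆ B` and `ε(t(aᵒ)) = a`.
-/
theorem IsComoduleSubring.comul_sub_mem {B : Subalgebra k H} (hB : IsComoduleSubring 𝓗 B)
    {b : H} (hb : b ∈ B) :
    𝓗.comul b - tmul _ _ 1 b ∈ imLeft (tgtAct 𝓗.η H) (srcAct 𝓗.η H)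
      ((augIdeal 𝓗 B).restrictScalars k) := by
  let T : HTensor 𝓗.η H H →ₗ[k] HTensor 𝓗.η H H :=
    LinearMap.id - BTensor.mk _ _ 1 ∘ₗ counitLeft 𝓗
  have hT : T (𝓗.comul b) = 𝓗.comul b - tmul _ _ 1 b := by
    simp [T, counitLeft_comul]
  rw [← hT]
  refine imLeft_le (T := (imLeft _ _ ((augIdeal 𝓗 B).restrictScalars k)).comap T)
    (fun x hx y => ?_) (hB.comul_mem_imLeft hb)
  have hxy : T (tmul _ _ x y) =
      tmul _ _ (x - tgt 𝓗.η (MulOpposite.op (𝓗.counit x))) y := by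
    have h₁ := tmul_act (tgtAct 𝓗.η H) (srcAct 𝓗.η H) 1 (𝓗.counit x) y
    have h₂ := ((BTensor.mk (tgtAct 𝓗.η H) (srcAct 𝓗.η H)).flip y).map_sub x
      (tgt 𝓗.η (MulOpposite.op (𝓗.counit x)))
    simp only [tgtAct_apply, srcAct_apply, smul_eq_mul, mul_one] at h₁
    simp only [LinearMap.flip_apply, mk_apply] at h₂
    simp [T, counitLeft_tmul, h₁, h₂]
  rw [Submodule.mem_comap, hxy]
  refine tmul_mem_imLeft ?_ y
  refine Ideal.subset_span ⟨B.sub_mem hx (hB.tgt_mem _), ?_⟩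
  rw [map_sub, counit_tgt_apply, MulOpposite.unop_op, sub_self]

theorem IsCoideal.mk' {I : Ideal H}
    (hΔ : ∀ x ∈ I, 𝓗.comul x ∈
      imLeft _ _ (I.restrictScalars k) ⊔ imRight _ _ (I.restrictScalars k))
    (hε : ∀ x ∈ I, 𝓗.counit x = 0) : IsCoideal 𝓗 (I.restrictScalars k) where
  src_mem _ _ hx := I.mul_mem_left _ hx
  tgt_mem _ _ hx := I.mul_mem_left _ hx
  comul_mem := hΔ
  counit_eq_zero := hε

/-- On generators, `Δ(b) = (Δ(b) - 1 ⊗ b) + 1 ⊗ b` splits into the two required images;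
multiplication by `Δ(a)` preserves each of them. -/
theorem IsComoduleSubring.isCoideal_augIdeal {B : Subalgebra k H} (hB : IsComoduleSubring 𝓗 B) :
    IsCoideal 𝓗 ((augIdeal 𝓗 B).restrictScalars k) := by
  refine .mk' (fun x hx => ?_) fun x => counit_eq_zero_of_mem_augIdeal B
  refine Submodule.span_induction (p := fun x _ => 𝓗.comul x ∈
    imLeft _ _ ((augIdeal 𝓗 B).restrictScalars k) ⊔
      imRight _ _ ((augIdeal 𝓗 B).restrictScalars k)) ?_ ?_ ?_ ?_ hx
  · intro b hb
    rw [← sub_add_cancel (𝓗.comul b) (tmul _ _ 1 b)]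
    exact Submodule.add_mem_sup (hB.comul_sub_mem hb.1)
      (tmul_mem_imRight 1 (Ideal.subset_span hb))
  · rw [map_zero]
    exact Submodule.zero_mem _
  · intro x y _ _ hx hy
    rw [map_add]
    exact add_mem hx hy
  · intro a x _ hx
    obtain ⟨z, hz, w, hw, hzw⟩ := Submodule.mem_sup.1 hx
    rw [smul_eq_mul, 𝓗.comul_mul, ← hzw, map_add]
    exact Submodule.add_mem_sup (takeuchiMul_mem_imLeft _ _ hz) (takeuchiMul_mem_imRight _ _ hw)

/-- The adjunction between `B ↦ H B⁺` and `I ↦ H^{co H/I}`. -/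
theorem IsComoduleSubring.augIdeal_le_iff {B : Subalgebra k H} (hB : IsComoduleSubring 𝓗 B)
    (I : Ideal H) : augIdeal 𝓗 B ≤ I ↔ B ≤ coinvariantSubalgebra 𝓗 I := by
  constructor
  · intro h b hb
    exact (mem_coinvariants_iff 𝓗 I b).2 (imLeft_mono (fun _ hx => h hx) (hB.comul_sub_mem hb))
  · intro h
    refine Ideal.span_le.2 fun b hb => ?_
    -- The map `x ⊗ y ↦ t(ε(y)) x` sends the image of `I ⊗_A H` into the left ideal `I`, and sends
    -- `Δ(b) - 1 ⊗ b` to `b - t(ε(b)) = b`.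
    have hT := imLeft_le (T := (I.restrictScalars k).comap (counitRight 𝓗)) (fun x hx y => by
      rw [Submodule.mem_comap, counitRight_tmul]
      exact I.mul_mem_left _ hx) ((mem_coinvariants_iff 𝓗 I b).1 (h hb.1))
    rw [Submodule.mem_comap, map_sub, counitRight_comul, counitRight_tmul, hb.2] at hT
    simpa using hT

/-! ### Suprema -/

theorem isCoideal_sSup {s : Set (Ideal H)} (hs : ∀ I ∈ s, IsCoideal 𝓗 (I.restrictScalars k)) :
    IsCoideal 𝓗 ((sSup s).restrictScalars k) := by
  refine .mk' (fun x hx => ?_) fun x hx => ?_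
  · rw [sSup_eq_iSup'] at hx
    refine Submodule.iSup_induction (fun I : s => (I : Ideal H))
      (motive := fun x => 𝓗.comul x ∈ imLeft _ _ ((sSup s).restrictScalars k) ⊔
        imRight _ _ ((sSup s).restrictScalars k)) hx ?_ ?_ ?_
    · intro I y hy
      have hle : I.1.restrictScalars k ≤ (sSup s).restrictScalars k := fun z hz =>
        (le_sSup I.2 : I.1 ≤ sSup s) hz
      exact sup_le_sup (imLeft_mono hle) (imRight_mono hle) ((hs I I.2).comul_mem y hy)
    · rw [map_zero]
      exact Submodule.zero_mem _
    · intro y z hy hz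
      rw [map_add]
      exact add_mem hy hz
  · rw [sSup_eq_iSup'] at hx
    refine Submodule.iSup_induction (fun I : s => (I : Ideal H))
      (motive := fun x => 𝓗.counit x = 0) hx ?_ (map_zero _) ?_
    · exact fun I y hy => (hs I I.2).counit_eq_zero y hy
    · intro y z hy hz
      rw [map_add, hy, hz, add_zero]

/-- The elements of a subalgebra `D` whose comultiplication lies in the image of `D ⊗_A H`. -/
def comulSubalgebra (𝓗 : LeftBialgebroid k A H) (D : Subalgebra k H) : Subalgebra k H :=
  ((imLeft _ _ (Subalgebra.toSubmodule D)).comap 𝓗.comul).toSubalgebra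
    (by
      rw [Submodule.mem_comap, 𝓗.comul_one]
      exact tmul_mem_imLeft D.one_mem 1)
    (fun x y hx hy => by
      rw [Submodule.mem_comap, 𝓗.comul_mul]
      refine imLeft_le (T := (imLeft _ _ (Subalgebra.toSubmodule D)).comap
        (takeuchiMul 𝓗.η ⟨𝓗.comul x, 𝓗.comul_mem x⟩)) (fun u hu v => ?_) hy
      rw [Submodule.mem_comap, takeuchiMul_tmul]
      exact mulRight₂_mem_imLeft (fun z hz => D.mul_mem hz hu) v hx)

/-- Multiplicativity of `Δ` makes `comulSubalgebra` a subalgebra, so containing each member of `s`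
suffices for it to contain their join. Nonemptiness provides `t(Aᵒ)`, which the empty join may miss.
-/
theorem isComoduleSubring_sSup (hflat : IsFlat (srcAct 𝓗.η H)) {s : Set (Subalgebra k H)}
    (hne : s.Nonempty) (hs : ∀ B ∈ s, IsComoduleSubring 𝓗 B) : IsComoduleSubring 𝓗 (sSup s) := by
  obtain ⟨B₀, hB₀⟩ := hne
  refine .of_comul_mem hflat (fun a => (le_sSup hB₀ : B₀ ≤ sSup s) ((hs B₀ hB₀).tgt_mem a)) ?_
  have h : sSup s ≤ comulSubalgebra 𝓗 (sSup s) := sSup_le fun B hB b hb =>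
    imLeft_mono (fun x hx => (le_sSup hB : B ≤ sSup s) hx) ((hs B hB).comul_mem_imLeft hb)
  exact fun b hb => h hb

/-- The least comodule subring, needed so that sets of lower bounds are nonempty. -/
theorem isComoduleSubring_range_tgt (hflat : IsFlat (srcAct 𝓗.η H)) :
    IsComoduleSubring 𝓗 (tgt 𝓗.η).range := by
  refine .of_comul_mem hflat (fun a => ⟨a, rfl⟩) ?_
  rintro _ ⟨a, rfl⟩
  change 𝓗.comul (tgt 𝓗.η a) ∈ _
  rw [comul_tgt_apply]
  exact tmul_mem_imLeft (Subalgebra.one_mem _) _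

theorem LeftIdealCoideal.exists_isLUB (s : Set (LeftIdealCoideal 𝓗)) : ∃ K, IsLUB s K := by
  refine ⟨⟨sSup ((fun I => I.1) '' s), isCoideal_sSup ?_⟩, fun I hI => ?_, fun J hJ => ?_⟩
  · rintro _ ⟨I, -, rfl⟩
    exact I.2
  · exact le_sSup (a := I.1) ⟨I, hI, rfl⟩
  · refine sSup_le (a := J.1) ?_
    rintro _ ⟨I, hI, rfl⟩
    exact hJ hI

theorem ComoduleSubring.exists_isLUB (hflat : IsFlat (srcAct 𝓗.η H))
    (s : Set (ComoduleSubring 𝓗)) (hne : s.Nonempty) : ∃ K, IsLUB s K := by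
  refine ⟨⟨sSup ((fun B => B.1) '' s), isComoduleSubring_sSup hflat (hne.image _) ?_⟩,
    fun B hB => ?_, fun C hC => ?_⟩
  · rintro _ ⟨B, -, rfl⟩
    exact B.2
  · exact le_sSup (a := B.1) ⟨B, hB, rfl⟩
  · refine sSup_le (a := C.1) ?_
    rintro _ ⟨B, hB, rfl⟩
    exact hC hB

end Correspondence

end Bialgebroid

theorem mainTheorem5 {k : Type uk} [Field k] {A : Type uA} [Ring A] [Algebra k A]
    {H : Type uH} [Ring H] [Algebra k H] (𝓗 : Bialgebroid.LeftBialgebroid k A H)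
    (hflat : Bialgebroid.IsFlat (Bialgebroid.srcAct 𝓗.η H)) :
    (∀ I J : Bialgebroid.LeftIdealCoideal 𝓗,
      (∃ K, IsLUB {I, J} K) ∧ (∃ K, IsGLB {I, J} K)) ∧
    (∀ B C : Bialgebroid.ComoduleSubring 𝓗,
      (∃ D, IsLUB {B, C} D) ∧ (∃ D, IsGLB {B, C} D)) ∧
    ∃ (Ψ : Bialgebroid.LeftIdealCoideal 𝓗 → Bialgebroid.ComoduleSubring 𝓗)
      (Φ : Bialgebroid.ComoduleSubring 𝓗 → Bialgebroid.LeftIdealCoideal 𝓗),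
      (∀ I, Subalgebra.toSubmodule (Ψ I).1 = Bialgebroid.coinvariants 𝓗 I.1) ∧
      (∀ B, (Φ B).1 = Bialgebroid.augIdeal 𝓗 B.1) ∧
      Monotone Ψ ∧ Monotone Φ ∧
      (∀ I, Ψ (Φ (Ψ I)) = Ψ I) ∧
      (∀ B, Φ (Ψ (Φ B)) = Φ B) ∧
      GaloisConnection Φ Ψ := by
  open Bialgebroid in
  let Ψ : LeftIdealCoideal 𝓗 → ComoduleSubring 𝓗 := fun I =>
    ⟨coinvariantSubalgebra 𝓗 I.1, isComoduleSubring_coinvariantSubalgebra hflat I.1⟩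
  let Φ : ComoduleSubring 𝓗 → LeftIdealCoideal 𝓗 := fun B =>
    ⟨augIdeal 𝓗 B.1, B.2.isCoideal_augIdeal⟩
  have gc : GaloisConnection Φ Ψ := fun B I => B.2.augIdeal_le_iff I.1
  refine ⟨fun I J => ⟨LeftIdealCoideal.exists_isLUB _, ?_⟩,
    fun B C => ⟨ComoduleSubring.exists_isLUB hflat _ (Set.insert_nonempty _ _), ?_⟩,
    Ψ, Φ, fun I => Submodule.toSubalgebra_toSubmodule _ _ _, fun B => rfl, gc.monotone_u,
    gc.monotone_l, gc.u_l_u_eq_u, gc.l_u_l_eq_l, gc⟩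
  -- An intersection of coideals need not be a coideal, so the meet is taken as the join of all
  -- common lower bounds.
  · obtain ⟨K, hK⟩ := LeftIdealCoideal.exists_isLUB (lowerBounds {I, J})
    exact ⟨K, isLUB_lowerBounds.1 hK⟩
  · have hbot : (lowerBounds {B, C}).Nonempty :=
      ⟨⟨(tgt 𝓗.η).range, isComoduleSubring_range_tgt hflat⟩, fun D _ => by
        change (tgt 𝓗.η).range ≤ D.1
        rintro _ ⟨a, rfl⟩
        exact D.2.tgt_mem a⟩
    obtain ⟨K, hK⟩ := ComoduleSubring.exists_isLUB hflat _ hbot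
    exact ⟨K, isLUB_lowerBounds.1 hK⟩
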